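/- For a topological space $X$, let $\Delta(X)$ be the dispersion character of $X$, i.e. the smallest cardinality of a non-empty open subset of $X$; let $w(X)$ be the weight of $X$, i.e. the smallest cardinality of a base of $X$; and let $\mathrm{pd}(X)$ be the pinning down number of $X$, i.e. the smallest cardinal $\kappa$ such that for every neighborhood assignment $U$ on $X$ (a map assigning to each $x\in X$ an open set $U(x)$ with $x\in U(x)$) there is a set $A\subseteq X$ with $|A|\le\kappa$ and $A\cap U(x)\neq\emptyset$ for all $x\in X$. Theorem. Every regular topological space $X$ satisfies $$\min\{\Delta(X),\, w(X)\}\le 2^{\mathrm{pd}(X)}.$$ -/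

import Mathlib

universe u

namespace PinningDown

open Cardinal

/-- A neighborhood assignment on `X`: every point is assigned an open set containing it. -/
def IsNbhdAssignment {X : Type u} [TopologicalSpace X] (U : X → Set X) : Prop :=
  ∀ x, IsOpen (U x) ∧ x ∈ U x

/-- `A` pins down the assignment `U` if it meets every `U x`. -/
def PinsDown {X : Type u} (A : Set X) (U : X → Set X) : Prop :=
  ∀ x, (A ∩ U x).Nonempty

/-- The pinning down number: the least cardinal `κ` such that every neighborhood assignment
is pinned down by a set of size at most `κ`. (Supersets of a pinning set still pin down, so
"at most `κ`" and "exactly `κ`" give the same least cardinal.) -/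
noncomputable def pd (X : Type u) [TopologicalSpace X] : Cardinal.{u} :=
  sInf {κ : Cardinal.{u} | ∀ U : X → Set X, IsNbhdAssignment U →
    ∃ A : Set X, #A ≤ κ ∧ PinsDown A U}

/-- The dispersion character: the least cardinality of a non-empty open subset
(`0` for the empty space, which has no such subset). -/
noncomputable def dispersionCharacter (X : Type u) [TopologicalSpace X] : Cardinal.{u} :=
  sInf {κ : Cardinal.{u} | ∃ U : Set X, IsOpen U ∧ U.Nonempty ∧ #U = κ}

/-- The weight: the least cardinality of a base of the topology. -/
noncomputable def weight (X : Type u) [TopologicalSpace X] : Cardinal.{u} :=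
  sInf {κ : Cardinal.{u} | ∃ B : Set (Set X), TopologicalSpace.IsTopologicalBasis B ∧ #B = κ}

end PinningDown

namespace PinningDown

open Cardinal Set

section

variable {X : Type u} [TopologicalSpace X]

/-! Regular open sets form a base of a regular space, so if the bound fails there are `(2 ^ pd X)⁺ ≤
Δ(X)` of them. Their nonempty differences `S \ closure T` are open and few enough to have distinct
representatives; a single assignment then yields a set of size at most `pd X` meeting them all,
whose traces separate the sets, a contradiction. The count of pairs uses that `pd X` is infinite; if
it is finite, a dense set of that size does the separating. -/

theorem exists_pinsDown_card_le_pd (U : X → Set X) (hU : IsNbhdAssignment U) :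
    ∃ A : Set X, #A ≤ pd X ∧ PinsDown A U := by
  have hne : {κ : Cardinal.{u} | ∀ U : X → Set X, IsNbhdAssignment U →
      ∃ A : Set X, #A ≤ κ ∧ PinsDown A U}.Nonempty :=
    ⟨#X, fun U hU => ⟨univ, by simp, fun x => ⟨x, mem_univ x, (hU x).2⟩⟩⟩
  exact csInf_mem hne U hU

theorem dispersionCharacter_le_mk {V : Set X} (hV : IsOpen V) (hne : V.Nonempty) :
    dispersionCharacter X ≤ #V :=
  csInf_le' ⟨V, hV, hne, rfl⟩

/-- A family of sets, each at least as large as the index type, has a system of distinct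
representatives. -/
theorem exists_injective_choice {ι α : Type u} (f : ι → Set α) (hf : ∀ i, #ι ≤ #(f i)) :
    ∃ g : ι → α, Function.Injective g ∧ ∀ i, g i ∈ f i := by
  -- For a well-order of type `(#ι).ord`, initial segments have fewer than `#ι` elements, so the
  -- recursion never exhausts `f i`.
  obtain ⟨r, wo, hr⟩ := Cardinal.exists_ord_eq ι
  have hwf : WellFounded r := IsWellFounded.wf
  have step : ∀ (i : ι) (g : ∀ j, r j i → α), ∃ x ∈ f i, ∀ j (h : r j i), g j h ≠ x := by
    intro i g
    by_contra! hcon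
    have h1 : #(f i) ≤ #{j // r j i} := by
      refine (Cardinal.mk_le_mk_of_subset (t := range fun j : {j // r j i} => g j.1 j.2)
        fun x hx => ?_).trans Cardinal.mk_range_le
      obtain ⟨j, h, e⟩ := hcon x hx
      exact ⟨⟨j, h⟩, e⟩
    have h2 : #{j // r j i} < #ι := Cardinal.card_typein_lt i hr
    exact absurd ((hf i).trans h1) h2.not_ge
  choose F hFmem hFne using step
  let g : ι → α := hwf.fix F
  have hg : ∀ i, g i = F i fun j _ => g j := fun i => hwf.fix_eq F i
  have hne : ∀ i j, r j i → g j ≠ g i := fun i j h => by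
    rw [hg i]; exact hFne i (fun j _ => g j) j h
  refine ⟨g, fun i j hij => ?_, fun i => by rw [hg i]; exact hFmem _ _⟩
  rcases trichotomous_of r i j with h | h | h
  · exact absurd hij (hne j i h)
  · exact h
  · exact absurd hij.symm (hne i j h)

/-- A family of at most `Δ(X)` open sets, each of which is nonempty, is met by a single set of
size at most `pd X`. -/
theorem exists_meets_family {ι : Type u} (f : ι → Set X) (ho : ∀ i, IsOpen (f i))
    (hne : ∀ i, (f i).Nonempty) (hι : #ι ≤ dispersionCharacter X) :
    ∃ A : Set X, #A ≤ pd X ∧ ∀ i, (A ∩ f i).Nonempty := by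
  classical
  obtain ⟨g, hg, hgf⟩ := exists_injective_choice f fun i =>
    hι.trans (dispersionCharacter_le_mk (ho i) (hne i))
  have hU : IsNbhdAssignment (Function.extend g f fun _ => univ) := by
    intro x
    by_cases hx : ∃ i, g i = x
    · obtain ⟨i, rfl⟩ := hx
      rw [hg.extend_apply]
      exact ⟨ho i, hgf i⟩
    · rw [Function.extend_apply' _ _ _ hx]
      exact ⟨isOpen_univ, mem_univ x⟩
  obtain ⟨A, hA, hp⟩ := exists_pinsDown_card_le_pd _ hU
  refine ⟨A, hA, fun i => ?_⟩
  have := hp (g i)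
  rwa [hg.extend_apply] at this

/-- Regular open sets are separated by their traces on a set meeting all their differences. -/
theorem mk_regularOpen_le_two_pow {R : Set (Set X)} {A : Set X}
    (hR : ∀ S ∈ R, interior (closure S) = S)
    (hA : ∀ S ∈ R, ∀ T ∈ R, (S \ closure T).Nonempty → (A ∩ (S \ closure T)).Nonempty) :
    #R ≤ 2 ^ #A := by
  have key : ∀ S ∈ R, ∀ T ∈ R, A ∩ S ⊆ T → S ⊆ T := by
    intro S hS T hT h
    have hcl : S ⊆ closure T := by
      rw [← sdiff_eq_empty, ← not_nonempty_iff_eq_empty]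
      intro hne
      obtain ⟨x, hxA, hxS, hxT⟩ := hA S hS T hT hne
      exact hxT (subset_closure (h ⟨hxA, hxS⟩))
    have hSo : IsOpen S := hR S hS ▸ isOpen_interior
    exact hR T hT ▸ interior_maximal hcl hSo
  rw [← Cardinal.mk_set]
  refine Cardinal.mk_le_of_injective (f := fun S : R => {a : A | (a : X) ∈ S.1}) ?_
  rintro ⟨S, hS⟩ ⟨T, hT⟩ h
  have h' : ∀ a : A, (a : X) ∈ S ↔ (a : X) ∈ T := fun a => Set.ext_iff.1 h a
  exact Subtype.ext <| (key S hS T hT fun x hx => (h' ⟨x, hx.1⟩).1 hx.2).antisymm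
    (key T hT S hS fun x hx => (h' ⟨x, hx.1⟩).2 hx.2)

/-- By regularity, the interiors of closed neighborhoods form a base, and they are regular open. -/
theorem weight_le_mk_regularOpen [RegularSpace X] :
    weight X ≤ #{S : Set X | interior (closure S) = S} := by
  refine csInf_le' ⟨_, TopologicalSpace.isTopologicalBasis_of_isOpen_of_nhds ?_ ?_, rfl⟩
  · intro S hS
    exact (show interior (closure S) = S from hS) ▸ isOpen_interior
  · intro x U hx hU
    obtain ⟨C, hC, hCc, hCU⟩ := exists_mem_nhds_isClosed_subset (hU.mem_nhds hx)
    refine ⟨interior C, ?_, mem_interior_iff_mem_nhds.2 hC, interior_subset.trans hCU⟩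
    refine Subset.antisymm (interior_mono (closure_minimal interior_subset hCc)) ?_
    exact interior_maximal subset_closure isOpen_interior

/-- In a regular space a finite pinning down number bounds the density. -/
theorem exists_dense_of_pd_lt_aleph0 [RegularSpace X] (h : pd X < ℵ₀) :
    ∃ A : Set X, #A ≤ pd X ∧ Dense A := by
  classical
  obtain ⟨n, hn⟩ := Cardinal.lt_aleph0.1 h
  -- A pinning set needs a separate point in each of the disjoint `W x`, so `m ≤ pd X`; an `A` of
  -- maximal size turns out to be dense.
  let P : ℕ → Prop := fun m => ∃ (A : Finset X) (W : X → Set X), A.card = m ∧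
    (∀ x ∈ A, IsOpen (W x) ∧ x ∈ W x) ∧ (A : Set X).PairwiseDisjoint W
  have hbound : ∀ m, P m → m ≤ n := by
    rintro m ⟨A, W, rfl, hW, hd⟩
    have hU : IsNbhdAssignment fun x => if x ∈ A then W x else univ := by
      intro x
      by_cases hx : x ∈ A
      · simpa [hx] using hW x hx
      · simp [hx]
    obtain ⟨B, hB, hp⟩ := exists_pinsDown_card_le_pd _ hU
    have hp' : ∀ x : A, ∃ b, b ∈ B ∧ b ∈ W x := fun x => by
      obtain ⟨b, hb, hbW⟩ := hp x
      exact ⟨b, hb, by simpa using hbW⟩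
    choose b hbB hbW using hp'
    have hinj : Function.Injective fun x : A => (⟨b x, hbB x⟩ : B) := by
      intro x y hxy
      have hxy' : b x = b y := congrArg Subtype.val hxy
      by_contra hne
      exact Set.disjoint_left.1 (hd x.2 y.2 fun e => hne (Subtype.ext e)) (hbW x)
        (hxy' ▸ hbW y)
    have := (Cardinal.mk_le_of_injective hinj).trans (hB.trans_eq hn)
    simpa using this
  have hP0 : P 0 := ⟨∅, fun _ => univ, by simp⟩
  obtain ⟨A, W, hcard, hW, hd⟩ := Nat.findGreatest_spec (P := P) (Nat.zero_le n) hP0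
  refine ⟨A, ?_, ?_⟩
  · rw [hn]
    simpa [hcard] using Nat.findGreatest_le (P := P) n
  · rw [dense_iff_inter_open]
    by_contra! hcon
    obtain ⟨O, hO, ⟨z, hz⟩, hOA⟩ := hcon
    obtain ⟨C, hC, hCc, hCO⟩ := exists_mem_nhds_isClosed_subset (hO.mem_nhds hz)
    have hAC : ∀ x ∈ A, x ∉ C := fun x hx hxC =>
      (Set.eq_empty_iff_forall_notMem.1 hOA x) ⟨hCO hxC, hx⟩
    have hzA : z ∉ A := fun hzA => hAC z hzA (mem_of_mem_nhds hC)
    have hsucc : P (A.card + 1) := by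
      -- Removing the closed `C` from the old neighborhoods makes room for `z`.
      refine ⟨insert z A, fun x => if x ∈ A then W x \ C else interior C,
        Finset.card_insert_of_notMem hzA, ?_, ?_⟩
      · intro x hx
        rcases Finset.mem_insert.1 hx with rfl | hx
        · simpa [hzA] using mem_interior_iff_mem_nhds.2 hC
        · simp only [hx, if_true]
          exact ⟨(hW x hx).1.sdiff hCc, (hW x hx).2, hAC x hx⟩
      · rw [Finset.coe_insert, Set.pairwiseDisjoint_insert_of_notMem (by simpa using hzA)]
        refine ⟨fun x hx y hy hxy => ?_, fun y hy => ?_⟩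
        · simp only [Function.onFun, Finset.mem_coe.1 hx, Finset.mem_coe.1 hy, if_true]
          exact (hd hx hy hxy).mono sdiff_subset sdiff_subset
        · simp only [hzA, Finset.mem_coe.1 hy, if_true, if_false]
          exact Set.disjoint_sdiff_right.mono_left interior_subset
    have := Nat.le_findGreatest (hbound _ hsucc) hsucc
    omega

end

end PinningDown

theorem mainTheorem4 (X : Type u) [TopologicalSpace X] [RegularSpace X] :
    min (PinningDown.dispersionCharacter X) (PinningDown.weight X)
      ≤ (2 : Cardinal.{u}) ^ PinningDown.pd X := by
  open PinningDown Cardinal in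
  rcases lt_or_ge (pd X) ℵ₀ with hfin | hinf
  · obtain ⟨A, hA, hAd⟩ := exists_dense_of_pd_lt_aleph0 hfin
    refine (min_le_right _ _).trans (weight_le_mk_regularOpen.trans ?_)
    refine (mk_regularOpen_le_two_pow (A := A) (fun _ h => h) fun S hS T _ hne => ?_).trans
      (Cardinal.power_le_power_left two_ne_zero hA)
    have hSo : IsOpen S := (show interior (closure S) = S from hS) ▸ isOpen_interior
    rw [Set.inter_comm]
    exact hAd.inter_open_nonempty _ (hSo.sdiff isClosed_closure) hne
  · by_contra! hcon
    obtain ⟨hΔ, hw⟩ := lt_min_iff.1 hcon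
    -- Exactly the successor: too large for `2 ^ pd X` traces, yet with at most `Δ(X)` pairs.
    obtain ⟨R, hRsub, hR⟩ := Cardinal.le_mk_iff_exists_subset.1
      ((Order.succ_le_of_lt hw).trans weight_le_mk_regularOpen)
    have hopen : ∀ S ∈ R, IsOpen S := fun S hS =>
      (show interior (closure S) = S from hRsub hS) ▸ isOpen_interior
    have hRinf : ℵ₀ ≤ #R := by
      rw [hR]
      exact hinf.trans ((Cardinal.cantor _).le.trans (Order.le_succ _))
    let ι := {p : R × R // (p.1.1 \ closure p.2.1).Nonempty}
    have hι : #ι ≤ dispersionCharacter X := by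
      refine (Cardinal.mk_subtype_le _).trans ?_
      rw [Cardinal.mk_prod, Cardinal.lift_id, Cardinal.mul_eq_self hRinf, hR]
      exact Order.succ_le_of_lt hΔ
    obtain ⟨A, hA, hmeet⟩ := exists_meets_family
      (fun p : ι => p.1.1.1 \ closure p.1.2.1)
      (fun p => (hopen _ p.1.1.2).sdiff isClosed_closure) (fun p => p.2) hι
    have hle : #R ≤ 2 ^ pd X :=
      (mk_regularOpen_le_two_pow (fun S hS => hRsub hS)
        fun S hS T hT hne => hmeet ⟨(⟨S, hS⟩, ⟨T, hT⟩), hne⟩).trans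
      (Cardinal.power_le_power_left two_ne_zero hA)
    rw [hR] at hle
    exact (Order.lt_succ _).not_ge hle
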